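/- **Setting.** Let $\mathcal X$ be a set of features, $\mathcal Y$ a finite set of labels with $|\mathcal Y|=N\ge 2$, and $\tilde{\mathcal Y}$ a finite set of noisy labels; $\mathcal D(\tilde{\mathcal Y})$ is the set of probability distributions on $\tilde{\mathcal Y}$. A noisy kernel is a map $\mathcal K$ assigning to each $(x,y)\in\mathcal X\times\mathcal Y$ a closed convex set $\mathcal K(x,y)\subset\mathcal D(\tilde{\mathcal Y})$. It is Hellinger-separated at scale $\gamma_H>0$ if $\inf_{p\in\mathcal K(x,y),\,q\in\mathcal K(x,y')}\sum_{m}(\sqrt{p[m]}-\sqrt{q[m]})^2\ge\gamma_H$ for all $x$ and all $y\ne y'$. Fix $T\ge 1$, a class $\mathcal H\subset\mathcal Y^{\mathcal X}$ and $\delta\in(0,1]$. Nature fixes $h\in\mathcal H$. In round $t=1,\dots,T$, an adversary selects $x_t\in\mathcal X$ as a function of $\tilde y_1,\dots,\tilde y_{t-1}$; the learner draws $\hat y_t\in\mathcal Y$ from a distribution $\Phi(x_1,\dots,x_t,\tilde y_1,\dots,\tilde y_{t-1})$ (independently of its earlier draws); then $\tilde y_t$ is drawn from a distribution in $\mathcal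 K(x_t,h(x_t))$ chosen by the adversary as a function of $\tilde y_1,\dots,\tilde y_{t-1}$. The high probability minimax risk $B^\delta(\mathcal H,\mathcal K)$ is the infimum of all $B\ge 0$ for which there is a predictor $\Phi$ with $\Pr\big[\sum_{t=1}^T 1\{h(x_t)\ne\hat y_t\}\ge B\big]\le\delta$ for every $h\in\mathcal H$ and every strategy of the adversary. The Littlestone dimension $\mathrm{Ldim}(\mathcal H)$ is the supremum of the $d$ for which there is a complete binary tree of depth $d$, with internal nodes labelled by features and the two edges below each internal node labelled by two distinct elements of $\mathcal Y$, such that every root-to-leaf path is realized by some $h\in\mathcal H$. **Statement.** There is an absolute constant $C>0$ such that, for all such data with $\mathrm{Ldim}(\mathcal H)<\infty$ and every noisy kernel $\mathcal K$ that is Hellinger-separated at scale $\gamma_H$, $$B^\delta(\mathcal H,\mathcal K)\le C\,\frac{\mathrm{Ldim}(\mathcal H)^2\log^2(TN)+\mathrm{Ldim}(\mathcal H)\log(4TN/\delta)}{\gamma_H}.$$ Moreover, if $\tilde{\mathcal Y}=\mathcal Y$, $0\le\eta<1$ and $\mathcal K^\eta(x,y)=\{(1-\eta')e_y+\eta' u:\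 0\le\eta'\le\eta\}$ is the randomized-response kernel ($e_y$ the point mass at $y$, $u$ the uniform distribution), then $$B^\delta(\mathcal H,\mathcal K^\eta)\le\frac{(\mathrm{Ldim}(\mathcal H)+1)\log(TN)+2\log(1/\delta)}{(1-\eta)^2/4}.$$ -/

import Mathlib

/-! ### Noisy kernels and separation -/

/-- A (set-valued) noisy kernel: to a feature `x` and a true label `y` it attaches a set of
vectors indexed by the noisy labels; `NoisyKernel.Valid` says these are probability vectors. -/
abbrev NoisyKernel (X Y Z : Type*) := X → Y → Set (Z → ℝ)

/-- Every `K x y` is a set of probability distributions on `Z`. -/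
def NoisyKernel.Valid {X Y Z : Type*} [Fintype Z] (K : NoisyKernel X Y Z) : Prop :=
  ∀ x y, K x y ⊆ stdSimplex ℝ Z

/-- Squared Hellinger distance `∑ (√p - √q)²`. -/
noncomputable def hellingerSq {Z : Type*} [Fintype Z] (p q : Z → ℝ) : ℝ :=
  ∑ z, (Real.sqrt (p z) - Real.sqrt (q z)) ^ 2

/-- `inf_{p ∈ P, q ∈ Q} L(p, q)`, as an extended nonnegative real. -/
noncomputable def setDivergence {Z : Type*} (L : (Z → ℝ) → (Z → ℝ) → ℝ)
    (P Q : Set (Z → ℝ)) : ENNReal :=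
  ⨅ p ∈ P, ⨅ q ∈ Q, ENNReal.ofReal (L p q)

/-- `K` is well-separated with respect to the divergence `L` at scale `γ > 0`. -/
def NoisyKernel.WellSeparated {X Y Z : Type*} (K : NoisyKernel X Y Z)
    (L : (Z → ℝ) → (Z → ℝ) → ℝ) (γ : ℝ) : Prop :=
  0 < γ ∧ ∀ x y y', y ≠ y' → ENNReal.ofReal γ ≤ setDivergence L (K x y) (K x y')

/-- The point mass `e_y`. -/
noncomputable def pointMass {Y : Type*} (y : Y) : Y → ℝ :=
  fun y' => open Classical in if y' = y then 1 else 0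

/-- The uniform distribution on `Y`. -/
noncomputable def uniformVec (Y : Type*) [Fintype Y] : Y → ℝ :=
  fun _ => 1 / (Fintype.card Y : ℝ)

/-- The randomized response kernel with noise level `η`. -/
noncomputable def randomizedResponse (X Y : Type*) [Fintype Y] (η : ℝ) : NoisyKernel X Y Y :=
  fun _ y => {p | ∃ η' ∈ Set.Icc 0 η, p = (1 - η') • pointMass y + η' • uniformVec Y}

/-! ### The noisy online classification game -/

/-- The first `t` entries of a sequence of length `T`. -/
def histPrefix {A : Type*} {T : ℕ} (z : Fin T → A) (t : ℕ) (ht : t ≤ T) : Fin t → A :=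
  fun i => z (Fin.castLE ht i)

/-- A (randomized) learner. In the round with 0-based index `t` it has seen the `t + 1` features
`x_0, …, x_t` and the `t` noisy labels `z_0, …, z_{t-1}`, and draws its prediction from the
probability vector `law t x z`, independently of its earlier draws. -/
structure Predictor (X Y Z : Type*) [Fintype Y] where
  law : (t : ℕ) → (Fin (t + 1) → X) → (Fin t → Z) → Y → ℝ
  law_mem : ∀ t x z, law t x z ∈ stdSimplex ℝ Y

/-- A strategy of Nature and the adversary in the game with `T` rounds, true hypothesis `h` and
kernel `K`: the features `x_t` are functions of the past noisy labels, and the conditional law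
`noise t z` of the noisy label in round `t` given the past noisy labels `z` belongs to
`K x_t (h x_t)`. -/
structure Adversary {X Y Z : Type*} (T : ℕ) (K : NoisyKernel X Y Z) (h : X → Y) where
  feature : (t : ℕ) → (Fin t → Z) → X
  noise : (t : ℕ) → (Fin t → Z) → Z → ℝ
  noise_mem : ∀ t < T, ∀ z : Fin t → Z,
    noise t z ∈ K (feature t z) (h (feature t z))

namespace Adversary

variable {X Y Z : Type*} {T : ℕ} {K : NoisyKernel X Y Z} {h : X → Y}

/-- The features `x_0, …, x_t` seen up to round `t` when the past noisy labels are `z`. -/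
def features (A : Adversary T K h) (t : ℕ) (z : Fin t → Z) : Fin (t + 1) → X :=
  fun s => A.feature s (histPrefix z s (Nat.lt_succ_iff.mp s.isLt))

/-- The probability of the noisy labels `z`. -/
noncomputable def labelProb (A : Adversary T K h) (z : Fin T → Z) : ℝ :=
  ∏ t : Fin T, A.noise t (histPrefix z t t.isLt.le) (z t)

/-- The conditional probability of the predictions `yhat` given the noisy labels `z`. -/
noncomputable def predProb [Fintype Y] (A : Adversary T K h) (Φ : Predictor X Y Z)
    (z : Fin T → Z) (yhat : Fin T → Y) : ℝ :=
  ∏ t : Fin T,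
    Φ.law t (A.features t (histPrefix z t t.isLt.le)) (histPrefix z t t.isLt.le) (yhat t)

/-- The cumulative error `∑ 1{h(x_t) ≠ yhat_t}`. -/
noncomputable def mistakes (A : Adversary T K h) (z : Fin T → Z) (yhat : Fin T → Y) : ℕ :=
  open Classical in
  ∑ t : Fin T, if h (A.feature t (histPrefix z t t.isLt.le)) ≠ yhat t then 1 else 0

/-- The probability, over noisy labels and predictions, that the cumulative error is `≥ B`. -/
noncomputable def errorProb [Fintype Y] [Fintype Z] (A : Adversary T K h)
    (Φ : Predictor X Y Z) (B : ℝ) : ℝ :=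
  open Classical in
  ∑ z : Fin T → Z, ∑ yhat : Fin T → Y,
    if B ≤ (A.mistakes z yhat : ℝ) then A.labelProb z * A.predProb Φ z yhat else 0

end Adversary

/-- The high probability minimax risk `B^δ(H, K)` in the game with `T` rounds: the infimum of the
`B ≥ 0` for which some predictor has cumulative error `≥ B` with probability at most `δ`, whatever
the true hypothesis in `H` and the strategy of the adversary. -/
noncomputable def highProbRisk {X Y Z : Type*} [Fintype Y] [Fintype Z]
    (T : ℕ) (H : Set (X → Y)) (K : NoisyKernel X Y Z) (δ : ℝ) : ℝ :=
  sInf {B : ℝ | 0 ≤ B ∧ ∃ Φ : Predictor X Y Z,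
    ∀ h ∈ H, ∀ A : Adversary T K h, A.errorProb Φ B ≤ δ}

/-! ### Littlestone dimension -/

/-- Complete binary trees of depth `d` whose internal nodes carry a feature and whose two edges
below each internal node carry two distinct labels. -/
inductive LittlestoneTree (X Y : Type*) : ℕ → Type _ where
  | leaf : LittlestoneTree X Y 0
  | node {d : ℕ} (x : X) (lab : Bool → Y) (hlab : lab false ≠ lab true)
      (child : Bool → LittlestoneTree X Y d) : LittlestoneTree X Y (d + 1)

/-- `h` takes the edge labels along the root-to-leaf path given by the turns `b`. -/
def LittlestoneTree.Realizes {X Y : Type*} (h : X → Y) :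
    {d : ℕ} → LittlestoneTree X Y d → (Fin d → Bool) → Prop
  | _, .leaf, _ => True
  | _, .node x lab _ child, b => h x = lab (b 0) ∧ (child (b 0)).Realizes h (Fin.tail b)

/-- Every root-to-leaf path is realized by a hypothesis of `H`. -/
def LittlestoneTree.ShatteredBy {X Y : Type*} {d : ℕ} (t : LittlestoneTree X Y d)
    (H : Set (X → Y)) : Prop :=
  ∀ b : Fin d → Bool, ∃ h ∈ H, t.Realizes h b

/-- The (multiclass) Littlestone dimension: the supremum of the depths of shattered trees. -/
noncomputable def littlestoneDim {X Y : Type*} (H : Set (X → Y)) : ℕ∞ :=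
  ⨆ (d : ℕ) (_ : ∃ t : LittlestoneTree X Y d, t.ShatteredBy H), (d : ℕ∞)

/-! ### Covering a class of finite Littlestone dimension by experts -/

/-! A class of Littlestone dimension L is followed by few experts. The standard optimal algorithm
loses a unit of dimension at each mistake, so along any feature sequence a hypothesis is described
by the at most L rounds in which the algorithm must be overridden, with the labels there
(`exists_expert`). There are at most (TN)^(L+1) such descriptions (`card_overrides_le`).

The learner runs multiplicative weights over these experts and predicts with the induced label
weights v. All rests on update factors g(y,z) with ∑_y v_y g(y,z) ≤ 1, so that the total weight
never grows, and with E[1/g(y,·)] ≤ κ(1 - c(1 - v_y)) under every noise law allowed for the true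
label y. As m = 1 - v_y is the probability of a mistake and (1 - cm)(1 + cm) ≤ 1, the ratio of
(1+c)^mistakes to the weight of a correct expert grows by at most a factor κ per round in
expectation; Markov's inequality finishes (`highProbRisk_le_of_updates`).

For randomized response g is explicit. For a Hellinger-separated kernel it comes from maximizing,
over mixture weights λ and p_y ∈ K(x,y), a perturbation of ∑_z (∑_y √(v_y λ_y p_y(z)))² + c ∑_y λ_y
(1 - v_y). Separation keeps the maximum close to 1 (`sum_sq_sum_sqrt_le`), and the first-order
condition towards each vertex is the required bound on 1/g (`exists_update_of_affinity_le`). -/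

theorem one_add_inv_pow_le_exp_one {T : ℕ} (hT : 1 ≤ T) :
    (1 + 1 / (T : ℝ)) ^ T ≤ Real.exp 1 := by
  have h1 : (1 + 1 / (T : ℝ)) ^ T ≤ Real.exp (1 / (T : ℝ)) ^ T := by
    gcongr
    linarith [Real.add_one_le_exp (1 / (T : ℝ))]
  rwa [← Real.exp_nat_mul, mul_one_div_cancel (Nat.cast_ne_zero.mpr (by omega))] at h1

theorem one_add_inv_pow_le_mul {T N : ℕ} (hT : 1 ≤ T) (hN : 2 ≤ N) :
    (1 + 1 / (T : ℝ)) ^ T ≤ (T : ℝ) * N := by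
  have hN' : (2 : ℝ) ≤ N := by exact_mod_cast hN
  rcases Nat.lt_or_ge T 2 with h | h
  · obtain rfl : T = 1 := by omega
    norm_num; linarith
  · have hT' : (2 : ℝ) ≤ T := by exact_mod_cast h
    nlinarith [Real.exp_one_lt_d9, one_add_inv_pow_le_exp_one hT]

section Cover

variable {X Y : Type*}

/-- Some tree of depth `d` is shattered by `V`. -/
def ShattersDepth (d : ℕ) (V : Set (X → Y)) : Prop :=
  ∃ t : LittlestoneTree X Y d, t.ShatteredBy V

/-- The hypotheses of `V` that take the value `y` at `x`. -/
def restrictTo (V : Set (X → Y)) (x : X) (y : Y) : Set (X → Y) := {h ∈ V | h x = y}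

theorem shattersDepth_zero {V : Set (X → Y)} {h : X → Y} (hh : h ∈ V) : ShattersDepth 0 V :=
  ⟨.leaf, fun _ => ⟨h, hh, trivial⟩⟩

theorem shattersDepth_succ {d : ℕ} {V : Set (X → Y)} {x : X} {y y' : Y} (hne : y ≠ y')
    (h1 : ShattersDepth d (restrictTo V x y)) (h2 : ShattersDepth d (restrictTo V x y')) :
    ShattersDepth (d + 1) V := by
  obtain ⟨t1, ht1⟩ := h1
  obtain ⟨t2, ht2⟩ := h2
  refine ⟨.node x (fun b => if b then y' else y) (by simpa using hne)
    (fun b => if b then t2 else t1), fun b => ?_⟩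
  cases hb : b 0
  · obtain ⟨h, ⟨hV, hx⟩, hr⟩ := ht1 (Fin.tail b)
    exact ⟨h, hV, by simpa [LittlestoneTree.Realizes, hb] using ⟨hx, hr⟩⟩
  · obtain ⟨h, ⟨hV, hx⟩, hr⟩ := ht2 (Fin.tail b)
    exact ⟨h, hV, by simpa [LittlestoneTree.Realizes, hb] using ⟨hx, hr⟩⟩

theorem not_shattersDepth_of_littlestoneDim_eq {H : Set (X → Y)} {L : ℕ}
    (hL : littlestoneDim H = (L : ℕ∞)) : ¬ ShattersDepth (L + 1) H := by
  intro hs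
  have h : ((L + 1 : ℕ) : ℕ∞) ≤ littlestoneDim H :=
    le_iSup₂ (f := fun (d : ℕ) (_ : ∃ t : LittlestoneTree X Y d, t.ShatteredBy H) => (d : ℕ∞))
      (L + 1) hs
  rw [hL] at h
  have := Nat.cast_le.mp h
  omega

/-- The version space and the bound on its dimension after `t` rounds, when the prediction of the
standard optimal algorithm is overridden as prescribed by `o`. -/
noncomputable def soaState (H : Set (X → Y)) (L : ℕ) (o : ℕ → Option Y) :
    (t : ℕ) → (Fin t → X) → Set (X → Y) × ℕ
  | 0, _ => (H, L)
  | t + 1, x =>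
    match o t with
    | none => soaState H L o t (Fin.init x)
    | some y =>
      (restrictTo (soaState H L o t (Fin.init x)).1 (x (Fin.last t)) y,
        (soaState H L o t (Fin.init x)).2 - 1)

theorem soaState_congr (H : Set (X → Y)) (L : ℕ) {o o' : ℕ → Option Y} (t : ℕ)
    (ho : ∀ s < t, o s = o' s) (x : Fin t → X) : soaState H L o t x = soaState H L o' t x := by
  induction t with
  | zero => rfl
  | succ t ih =>
    simp only [soaState, ho t (Nat.lt_succ_self t),
      ih (fun s hs => ho s (hs.trans (Nat.lt_succ_self t)))]

variable [Nonempty Y]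

/-- The label predicted by the standard optimal algorithm: the label whose version space still
shatters a tree of depth `d`, if there is one. -/
noncomputable def soaLabel (s : Set (X → Y) × ℕ) (x : X) : Y :=
  open Classical in
  if h : ∃ y, ShattersDepth s.2 (restrictTo s.1 x y) then h.choose else Classical.arbitrary Y

/-- Two different labels that both keep the full depth would combine into a shattered tree one level
deeper. -/
theorem eq_soaLabel {s : Set (X → Y) × ℕ} (hs : ¬ ShattersDepth (s.2 + 1) s.1) {x : X} {y : Y}
    (hy : ShattersDepth s.2 (restrictTo s.1 x y)) : y = soaLabel s x := by
  have hex : ∃ y, ShattersDepth s.2 (restrictTo s.1 x y) := ⟨y, hy⟩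
  rw [soaLabel, dif_pos hex]
  by_contra hne
  exact hs (shattersDepth_succ hne hy hex.choose_spec)

/-- The prediction of the expert given by the overrides `o`. -/
noncomputable def soaExpert (H : Set (X → Y)) (L : ℕ) (o : ℕ → Option Y) (t : ℕ)
    (x : Fin (t + 1) → X) : Y :=
  (o t).getD (soaLabel (soaState H L o t (Fin.init x)) (x (Fin.last t)))

/-- Overrides that make the expert follow `h` along the features `x`. -/
theorem exists_overrides {H : Set (X → Y)} {L : ℕ} (hL : ¬ ShattersDepth (L + 1) H) {h : X → Y}
    (hh : h ∈ H) (T : ℕ) (x : Fin T → X) :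
    ∃ o : ℕ → Option Y, (∀ t (ht : t < T), soaExpert H L o t (histPrefix x (t + 1) ht) =
        h (x ⟨t, ht⟩)) ∧
      h ∈ (soaState H L o T x).1 ∧
      ¬ ShattersDepth ((soaState H L o T x).2 + 1) (soaState H L o T x).1 ∧
      ((Finset.range T).filter (fun t => (o t).isSome)).card + (soaState H L o T x).2 = L := by
  induction T with
  | zero => exact ⟨fun _ => none, by simp, hh, hL, by simp [soaState]⟩
  | succ T ih =>
    obtain ⟨o, hex, hmem, hsh, hcard⟩ := ih (Fin.init x)
    set s := soaState H L o T (Fin.init x) with hs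
    let a : Option Y :=
      open Classical in
      if h (x (Fin.last T)) = soaLabel s (x (Fin.last T)) then none else some (h (x (Fin.last T)))
    let o' : ℕ → Option Y := Function.update o T a
    have ho' : ∀ t < T, o' t = o t := fun t ht => Function.update_of_ne ht.ne _ _
    have hoT : o' T = a := Function.update_self _ _ _
    have hst : soaState H L o' T (Fin.init x) = s := soaState_congr H L T ho' _
    have hfil : (Finset.range T).filter (fun t => (o' t).isSome) =
        (Finset.range T).filter (fun t => (o t).isSome) :=
      Finset.filter_congr fun t ht => by rw [ho' t (Finset.mem_range.mp ht)]
    refine ⟨o', fun t ht => ?_, ?_⟩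
    · rcases Nat.lt_succ_iff_lt_or_eq.mp ht with hlt | rfl
      · rw [← show _ = h (x ⟨t, ht⟩) from hex t hlt]
        unfold soaExpert
        rw [ho' t hlt, soaState_congr H L t (fun s hs => ho' s (hs.trans hlt))]
        rfl
      · change (o' t).getD (soaLabel (soaState H L o' t (Fin.init x)) (x (Fin.last t))) =
          h (x (Fin.last t))
        rw [hst, hoT]
        by_cases hc : h (x (Fin.last t)) = soaLabel s (x (Fin.last t))
        · simp [a, hc]
        · simp [a, hc]
    · rw [Finset.range_add_one, Finset.filter_insert, hfil, hoT]
      by_cases hc : h (x (Fin.last T)) = soaLabel s (x (Fin.last T))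
      · have ha : a = none := by simp [a, hc]
        have hs' : soaState H L o' (T + 1) x = s := by simp only [soaState, hoT, ha, hst]
        rw [hs', ha]
        exact ⟨hmem, hsh, by simpa using hcard⟩
      · have ha : a = some (h (x (Fin.last T))) := by simp [a, hc]
        have hs' : soaState H L o' (T + 1) x =
            (restrictTo s.1 (x (Fin.last T)) (h (x (Fin.last T))), s.2 - 1) := by
          simp only [soaState, hoT, ha, hst]
        have hm : h ∈ restrictTo s.1 (x (Fin.last T)) (h (x (Fin.last T))) := ⟨hmem, rfl⟩
        have hns : ¬ ShattersDepth s.2 (restrictTo s.1 (x (Fin.last T)) (h (x (Fin.last T)))) :=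
          fun hcon => hc (eq_soaLabel hsh hcon)
        -- `h` alone shatters depth `0`, so the truncated subtraction in `soaState` is exact here.
        have hpos : s.2 ≠ 0 := by
          intro h0
          rw [h0] at hns
          exact hns (shattersDepth_zero hm)
        rw [hs', ha]
        refine ⟨hm, ?_, ?_⟩
        · rwa [show s.2 - 1 + 1 = s.2 by omega]
        · simp only [Option.isSome_some, if_true]
          rw [Finset.card_insert_of_notMem (by simp)]
          omega

/-- Override sequences of length `T` with at most `L` overrides. -/
abbrev Overrides (Y : Type*) (T L : ℕ) : Type _ :=
  {o : Fin T → Option Y // (Finset.univ.filter fun t => (o t).isSome).card ≤ L}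

/-- The extension of an override sequence by no overrides. -/
def Overrides.extend {T L : ℕ} (o : Overrides Y T L) (t : ℕ) : Option Y :=
  if h : t < T then o.1 ⟨t, h⟩ else none

instance (T L : ℕ) : Nonempty (Overrides Y T L) := ⟨⟨fun _ => none, by simp⟩⟩

/-- Give each override weight q = 1/(TN). All sequences together weigh (1 + Nq)^T = (1 + 1/T)^T ≤
TN, while each admissible one weighs at least q^L. -/
theorem card_overrides_le [Fintype Y] (T L : ℕ) (hT : 1 ≤ T) (hN : 2 ≤ Fintype.card Y) :
    (Nat.card (Overrides Y T L) : ℝ) ≤ ((T : ℝ) * Fintype.card Y) ^ (L + 1) := by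
  classical
  set N := Fintype.card Y with hNdef
  have hN' : (2 : ℝ) ≤ N := by exact_mod_cast hN
  have hT' : (1 : ℝ) ≤ T := by exact_mod_cast hT
  have hTN : (1 : ℝ) ≤ T * N := by nlinarith
  set q : ℝ := ((T : ℝ) * N)⁻¹ with hq
  have hq0 : 0 < q := by positivity
  have hq1 : q ≤ 1 := inv_le_one_of_one_le₀ hTN
  have hsum : ∑ o : Fin T → Option Y, ∏ t, (if (o t).isSome then q else 1) =
      (1 + 1 / (T : ℝ)) ^ T := by
    have h1 : ∑ a : Option Y, (if a.isSome then q else 1) = 1 + 1 / (T : ℝ) := by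
      rw [Fintype.sum_option]
      simp only [Option.isSome_none, Option.isSome_some, if_true, Finset.sum_const,
        Finset.card_univ, nsmul_eq_mul, ← hNdef, hq]
      simp only [Bool.false_eq_true, if_false]
      field_simp
    rw [← Fintype.piFinset_univ, ← Finset.prod_univ_sum (fun _ : Fin T => Finset.univ)
      (fun _ (a : Option Y) => if a.isSome then q else (1 : ℝ))]
    simp [h1]
  have hle : (Nat.card (Overrides Y T L) : ℝ) * q ^ L ≤
      ∑ o : Fin T → Option Y, ∏ t, (if (o t).isSome then q else 1) := by
    rw [Nat.card_eq_fintype_card, Fintype.card_subtype, ← nsmul_eq_mul, ← Finset.sum_const]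
    refine (Finset.sum_le_sum fun o ho => ?_).trans
      (Finset.sum_le_sum_of_subset_of_nonneg (Finset.filter_subset _ _) fun o _ _ =>
        Finset.prod_nonneg fun t _ => by split_ifs <;> positivity)
    rw [Finset.prod_ite]
    simp only [Finset.prod_const, one_pow, mul_one]
    exact pow_le_pow_of_le_one hq0.le hq1 (Finset.mem_filter.mp ho).2
  rw [hsum] at hle
  have h2 := hle.trans (one_add_inv_pow_le_mul hT hN)
  rw [hq, inv_pow, ← div_eq_mul_inv, div_le_iff₀ (by positivity)] at h2
  rw [pow_succ']
  exact h2

/-- The experts given by the override sequences cover the class. -/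
theorem exists_expert {H : Set (X → Y)} {L : ℕ} (hL : ¬ ShattersDepth (L + 1) H) {h : X → Y}
    (hh : h ∈ H) (T : ℕ) (x : Fin T → X) :
    ∃ o : Overrides Y T L, ∀ t : Fin T,
      soaExpert H L o.extend t (histPrefix x (t + 1) t.isLt) = h (x t) := by
  obtain ⟨o, hex, -, -, hcard⟩ := exists_overrides hL hh T x
  have hle : (Finset.univ.filter fun t : Fin T => (o t).isSome).card ≤ L := by
    refine le_trans (le_of_eq ?_) (Nat.le.intro hcard)
    rw [← Finset.card_map Fin.valEmbedding]
    congr 1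
    ext t
    simp only [Finset.mem_map, Finset.mem_filter, Finset.mem_univ, true_and,
      Fin.valEmbedding_apply, Finset.mem_range]
    constructor
    · rintro ⟨s, hs, rfl⟩
      exact ⟨s.isLt, hs⟩
    · rintro ⟨h1, h2⟩
      exact ⟨⟨t, h1⟩, h2, rfl⟩
  refine ⟨⟨fun t => o t, hle⟩, fun t => ?_⟩
  have hext : ∀ s < (t : ℕ) + 1,
      Overrides.extend (⟨fun t => o t, hle⟩ : Overrides Y T L) s = o s :=
    fun s hs => dif_pos (lt_of_lt_of_le hs t.isLt)
  rw [← hex t t.isLt]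
  unfold soaExpert
  rw [hext t (Nat.lt_succ_self _),
    soaState_congr H L t (fun s hs => hext s (hs.trans (Nat.lt_succ_self _)))]

end Cover

/-! ### Exponential weights with multiplicative updates -/

/-- The supermartingale inequality in product form: summing out the last label first costs one
factor `κ`. -/
theorem sum_prod_histPrefix_le {Z : Type*} [Fintype Z] {κ : ℝ} (hκ : 0 ≤ κ) (T : ℕ)
    (a : (t : ℕ) → (Fin t → Z) → Z → ℝ) (ha : ∀ t < T, ∀ p z, 0 ≤ a t p z)
    (hsum : ∀ t < T, ∀ p, ∑ z, a t p z ≤ κ) :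
    ∑ z : Fin T → Z, ∏ t : Fin T, a t (histPrefix z t t.isLt.le) (z t) ≤ κ ^ T := by
  induction T with
  | zero => simp
  | succ T ih =>
    have ih' := ih (fun t ht => ha t (ht.trans (Nat.lt_succ_self _)))
      (fun t ht => hsum t (ht.trans (Nat.lt_succ_self _)))
    rw [← (Fin.snocEquiv fun _ : Fin (T + 1) => Z).sum_comp, Fintype.sum_prod_type_right]
    have hsplit : ∀ (p : Fin T → Z) (ζ : Z),
        ∏ t : Fin (T + 1), a t (histPrefix (Fin.snocEquiv (fun _ : Fin (T + 1) => Z) (ζ, p)) t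
          t.isLt.le) (Fin.snocEquiv (fun _ : Fin (T + 1) => Z) (ζ, p) t) =
        (∏ t : Fin T, a t (histPrefix p t t.isLt.le) (p t)) * a T p ζ := by
      intro p ζ
      have hpre : ∀ (t : ℕ) (ht : t ≤ T), histPrefix (Fin.snoc (α := fun _ => Z) p ζ) t
          (ht.trans (Nat.le_succ T)) = histPrefix p t ht := by
        intro t ht
        funext s
        exact Fin.snoc_castSucc (α := fun _ => Z) ζ p (Fin.castLE ht s)
      rw [Fin.prod_univ_castSucc]
      congr 1
      · refine Finset.prod_congr rfl fun t _ => ?_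
        congr 1
        · exact hpre t t.isLt.le
        · exact Fin.snoc_castSucc (α := fun _ => Z) ζ p t
      · congr 1
        · exact hpre T le_rfl
        · exact Fin.snoc_last (α := fun _ => Z) ζ p
    simp only [hsplit]
    calc ∑ p : Fin T → Z, ∑ ζ, (∏ t : Fin T, a t (histPrefix p t t.isLt.le) (p t)) * a T p ζ
        ≤ ∑ p : Fin T → Z, (∏ t : Fin T, a t (histPrefix p t t.isLt.le) (p t)) * κ := by
          refine Finset.sum_le_sum fun p _ => ?_
          rw [← Finset.mul_sum]
          exact mul_le_mul_of_nonneg_left (hsum T (Nat.lt_succ_self _) p)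
            (Finset.prod_nonneg fun t _ => ha t (t.isLt.trans (Nat.lt_succ_self _)) _ _)
      _ ≤ κ ^ (T + 1) := by
          rw [← Finset.sum_mul, pow_succ]
          exact mul_le_mul_of_nonneg_right ih' hκ

section Weights

variable {X Y Z ι : Type*} [Fintype ι]

/-- The normalized weight vector that the experts put on the labels. -/
noncomputable def labelWeights (w : ι → ℝ) (e : ι → Y) (y : Y) : ℝ :=
  open Classical in
  (∑ i, if e i = y then w i else 0) / ∑ i, w i

theorem labelWeights_mem [Fintype Y] [Nonempty ι] {w : ι → ℝ} (hw : ∀ i, 0 < w i) (e : ι → Y) :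
    labelWeights w e ∈ stdSimplex ℝ Y := by
  classical
  have hpos : 0 < ∑ i, w i := Finset.sum_pos (fun i _ => hw i) Finset.univ_nonempty
  refine ⟨fun y => div_nonneg (Finset.sum_nonneg fun i _ => ?_) hpos.le, ?_⟩
  · split_ifs
    exacts [(hw i).le, le_rfl]
  · unfold labelWeights
    rw [← Finset.sum_div, Finset.sum_comm]
    simp [hpos.ne']

theorem sum_mul_eq_labelWeights [Fintype Y] [Nonempty ι] {w : ι → ℝ} (hw : ∀ i, 0 < w i)
    (e : ι → Y) (g : Y → ℝ) : ∑ i, w i * g (e i) = (∑ i, w i) * ∑ y, labelWeights w e y * g y := by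
  classical
  have hpos : 0 < ∑ i, w i := Finset.sum_pos (fun i _ => hw i) Finset.univ_nonempty
  have h1 : ∑ y, labelWeights w e y * g y = (∑ i, w i * g (e i)) / ∑ i, w i := by
    unfold labelWeights
    simp only [div_mul_eq_mul_div, ← Finset.sum_div, Finset.sum_mul]
    rw [Finset.sum_comm]
    simp [ite_mul]
  rw [h1, mul_div_cancel₀ _ hpos.ne']

/-- The weights of the experts `E` after `t` rounds, when the update factors in a round with
feature `x` and label weights `v` are `g x v`. -/
noncomputable def expertWeights (E : (t : ℕ) → (Fin (t + 1) → X) → ι → Y)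
    (g : X → (Y → ℝ) → Y → Z → ℝ) : (t : ℕ) → (Fin t → X) → (Fin t → Z) → ι → ℝ
  | 0, _, _, _ => 1
  | t + 1, x, z, i =>
    expertWeights E g t (Fin.init x) (Fin.init z) i *
      g (x (Fin.last t)) (labelWeights (expertWeights E g t (Fin.init x) (Fin.init z)) (E t x))
        (E t x i) (z (Fin.last t))

variable {E : (t : ℕ) → (Fin (t + 1) → X) → ι → Y} {g : X → (Y → ℝ) → Y → Z → ℝ}

theorem expertWeights_pos (hg : ∀ x v y z, 0 < g x v y z) (t : ℕ) (x : Fin t → X)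
    (z : Fin t → Z) (i : ι) : 0 < expertWeights E g t x z i := by
  induction t with
  | zero => exact one_pos
  | succ t ih => exact mul_pos (ih _ _) (hg _ _ _ _)

/-- Grouped by predicted label, the total weight is multiplied in each round by the `v`-average of
the factors, which is at most one. -/
theorem sum_expertWeights_le [Fintype Y] [Nonempty ι] (hg : ∀ x v y z, 0 < g x v y z)
    (hg1 : ∀ x, ∀ v ∈ stdSimplex ℝ Y, ∀ z, ∑ y, v y * g x v y z ≤ 1) (t : ℕ) (x : Fin t → X)
    (z : Fin t → Z) : ∑ i, expertWeights E g t x z i ≤ Fintype.card ι := by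
  induction t with
  | zero => simp [expertWeights]
  | succ t ih =>
    have hw := expertWeights_pos (E := E) hg t (Fin.init x) (Fin.init z)
    simp only [expertWeights]
    rw [sum_mul_eq_labelWeights hw (E t x) (fun y => g (x (Fin.last t))
      (labelWeights (expertWeights E g t (Fin.init x) (Fin.init z)) (E t x)) y (z (Fin.last t)))]
    refine le_trans (mul_le_of_le_one_right (Finset.sum_nonneg fun i _ => (hw i).le)
      (hg1 _ _ (labelWeights_mem hw _) _)) (ih _ _)

/-- The label weights in the round with index `t`. -/
noncomputable def roundWeights (E : (t : ℕ) → (Fin (t + 1) → X) → ι → Y)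
    (g : X → (Y → ℝ) → Y → Z → ℝ) (t : ℕ) (x : Fin (t + 1) → X) (z : Fin t → Z) : Y → ℝ :=
  labelWeights (expertWeights E g t (Fin.init x) z) (E t x)

/-- The learner that predicts with the current label weights. -/
noncomputable def weightsPredictor [Fintype Y] [Nonempty ι]
    (E : (t : ℕ) → (Fin (t + 1) → X) → ι → Y)
    (g : X → (Y → ℝ) → Y → Z → ℝ) (hg : ∀ x v y z, 0 < g x v y z) : Predictor X Y Z where
  law := roundWeights E g
  law_mem t _ z := labelWeights_mem (expertWeights_pos hg t _ z) _

/-- Updates see only predicted labels, so the right-hand side does not involve `i`. This allows the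
expert to be chosen in hindsight. -/
theorem expertWeights_eq_prod {T : ℕ} {x : Fin T → X} {f : Fin T → Y} {i : ι}
    (hi : ∀ t : Fin T, E t (histPrefix x (t + 1) t.isLt) i = f t) (z : Fin T → Z) :
    expertWeights E g T x z i =
      ∏ t : Fin T, g (x t) (roundWeights E g t (histPrefix x (t + 1) t.isLt)
        (histPrefix z t t.isLt.le)) (f t) (z t) := by
  induction T with
  | zero => rfl
  | succ T ih =>
    have ih' := ih (x := Fin.init x) (f := Fin.init f) (fun t => hi t.castSucc) (Fin.init z)
    rw [Fin.prod_univ_castSucc]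
    simp only [expertWeights]
    rw [ih']
    have hlast := hi (Fin.last T)
    change E T x i = _ at hlast
    rw [hlast]
    rfl

end Weights

/-! ### From exponential moments of the number of mistakes to the minimax risk -/

section Risk

variable {X Y Z : Type*} {T : ℕ} {K : NoisyKernel X Y Z} {h : X → Y}

theorem Adversary.predProb_nonneg [Fintype Y] (A : Adversary T K h) (Φ : Predictor X Y Z)
    (z : Fin T → Z) (yhat : Fin T → Y) : 0 ≤ A.predProb Φ z yhat :=
  Finset.prod_nonneg fun _ _ => (Φ.law_mem _ _ _).1 _

theorem Adversary.labelProb_nonneg [Fintype Z] (hK : K.Valid) (A : Adversary T K h)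
    (z : Fin T → Z) : 0 ≤ A.labelProb z :=
  Finset.prod_nonneg fun t _ => (hK _ _ (A.noise_mem t t.isLt _)).1 _

/-- The exponential moment of the number of mistakes given the noisy labels. -/
theorem Adversary.sum_predProb_mul_pow [Fintype Y] (A : Adversary T K h) (Φ : Predictor X Y Z)
    (z : Fin T → Z) (c : ℝ) :
    ∑ yhat : Fin T → Y, A.predProb Φ z yhat * (1 + c) ^ A.mistakes z yhat =
      ∏ t : Fin T, (1 + c * (1 - Φ.law t (A.features t (histPrefix z t t.isLt.le))
        (histPrefix z t t.isLt.le) (h (A.feature t (histPrefix z t t.isLt.le))))) := by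
  classical
  let f : Fin T → Y → ℝ := fun t y =>
    Φ.law t (A.features t (histPrefix z t t.isLt.le)) (histPrefix z t t.isLt.le) y *
      (1 + c) ^ (if h (A.feature t (histPrefix z t t.isLt.le)) ≠ y then 1 else 0)
  have h1 : ∀ yhat : Fin T → Y, A.predProb Φ z yhat * (1 + c) ^ A.mistakes z yhat =
      ∏ t, f t (yhat t) := by
    intro yhat
    simp only [f, Finset.prod_mul_distrib, Finset.prod_pow_eq_pow_sum]
    rfl
  simp only [h1]
  rw [← Fintype.piFinset_univ, ← Finset.prod_univ_sum (fun _ : Fin T => Finset.univ) f]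
  refine Finset.prod_congr rfl fun t _ => ?_
  have hlaw := (Φ.law_mem t (A.features t (histPrefix z t t.isLt.le))
    (histPrefix z t t.isLt.le)).2
  set q := Φ.law t (A.features t (histPrefix z t t.isLt.le)) (histPrefix z t t.isLt.le)
  set y0 := h (A.feature t (histPrefix z t t.isLt.le))
  have h2 : ∀ y, f t y = q y + c * (q y - if y0 = y then q y else 0) := by
    intro y
    change q y * (1 + c) ^ (if y0 ≠ y then 1 else 0) = _
    by_cases hy : y0 = y
    · simp [hy]
    · simp [hy]; ring
  simp only [h2, Finset.sum_add_distrib, ← Finset.mul_sum, Finset.sum_sub_distrib, hlaw]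
  simp

variable [Fintype Y] [Fintype Z]

/-- Markov's inequality for (1+c)^mistakes. -/
theorem Adversary.errorProb_mul_rpow_le (hK : K.Valid) (A : Adversary T K h)
    (Φ : Predictor X Y Z) {c : ℝ} (hc : 0 ≤ c) (B : ℝ) :
    A.errorProb Φ B * (1 + c) ^ B ≤
      ∑ z, A.labelProb z * ∑ yhat, A.predProb Φ z yhat * (1 + c) ^ A.mistakes z yhat := by
  classical
  unfold Adversary.errorProb
  rw [Finset.sum_mul]
  refine Finset.sum_le_sum fun z _ => ?_
  rw [Finset.sum_mul, Finset.mul_sum]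
  refine Finset.sum_le_sum fun yhat _ => ?_
  have h1 := A.labelProb_nonneg hK z
  have h2 := A.predProb_nonneg Φ z yhat
  split_ifs with hB
  · rw [← mul_assoc]
    refine mul_le_mul_of_nonneg_left ?_ (mul_nonneg h1 h2)
    rw [← Real.rpow_natCast]
    exact Real.rpow_le_rpow_of_exponent_le (by linarith) hB
  · rw [zero_mul]
    have : 0 ≤ (1 + c) ^ A.mistakes z yhat := by positivity
    positivity

theorem highProbRisk_le {H : Set (X → Y)} {δ B : ℝ} (hB : 0 ≤ B) (Φ : Predictor X Y Z)
    (hΦ : ∀ h ∈ H, ∀ A : Adversary T K h, A.errorProb Φ B ≤ δ) : highProbRisk T H K δ ≤ B :=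
  csInf_le ⟨0, fun _ hb => hb.1⟩ ⟨hB, Φ, hΦ⟩

/-- Risk bound for exponential weights over a finite family of experts covering the class, when
the updates decrease the reciprocal weight of the truth in proportion to the probability of a
mistake. -/
theorem highProbRisk_le_of_updates {ι : Type*} [Fintype ι] [Nonempty ι] {H : Set (X → Y)}
    (hK : K.Valid) (E : (t : ℕ) → (Fin (t + 1) → X) → ι → Y)
    (hE : ∀ h ∈ H, ∀ x : Fin T → X, ∃ i, ∀ t : Fin T,
      E t (histPrefix x (t + 1) t.isLt) i = h (x t))
    {κ c : ℝ} (hκ : 1 ≤ κ) (hc : 0 < c)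
    (hup : ∀ x, ∀ v ∈ stdSimplex ℝ Y, ∃ g : Y → Z → ℝ, (∀ y z, 0 < g y z) ∧
      (∀ z, ∑ y, v y * g y z ≤ 1) ∧
      ∀ y, ∀ p ∈ K x y, ∑ z, p z / g y z ≤ κ * (1 - c * (1 - v y)))
    {δ B : ℝ} (hB : 0 ≤ B) (hδ : Fintype.card ι * κ ^ T ≤ δ * (1 + c) ^ B) :
    highProbRisk T H K δ ≤ B := by
  -- Off the simplex the factor is set to `1`, so that positivity holds for every `v`.
  have hup' : ∀ x v, ∃ g : Y → Z → ℝ, (∀ y z, 0 < g y z) ∧ (v ∈ stdSimplex ℝ Y →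
      (∀ z, ∑ y, v y * g y z ≤ 1) ∧
      ∀ y, ∀ p ∈ K x y, ∑ z, p z / g y z ≤ κ * (1 - c * (1 - v y))) := by
    intro x v
    by_cases hv : v ∈ stdSimplex ℝ Y
    · obtain ⟨g, hg, hg'⟩ := hup x v hv
      exact ⟨g, hg, fun _ => hg'⟩
    · exact ⟨fun _ _ => 1, fun _ _ => one_pos, fun hv' => absurd hv' hv⟩
  choose g hg hg' using hup'
  refine highProbRisk_le hB (weightsPredictor E g hg) fun h hh A => ?_
  have hcB : 0 < (1 + c) ^ B := Real.rpow_pos_of_pos (by linarith) B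
  refine le_of_mul_le_mul_right ?_ hcB
  refine (A.errorProb_mul_rpow_le hK _ hc.le B).trans (le_trans ?_ hδ)
  simp only [A.sum_predProb_mul_pow]
  -- one round of the supermartingale
  let v : (t : ℕ) → (Fin t → Z) → Y → ℝ := fun t z => roundWeights E g t (A.features t z) z
  let a : (t : ℕ) → (Fin t → Z) → Z → ℝ := fun t z ζ =>
    A.noise t z ζ / g (A.feature t z) (v t z) (h (A.feature t z)) ζ *
      (1 + c * (1 - v t z (h (A.feature t z))))
  have hv : ∀ t z, v t z ∈ stdSimplex ℝ Y := fun t z => (weightsPredictor E g hg).law_mem t _ z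
  have hv1 : ∀ t z y, v t z y ≤ 1 := fun t z y => (hv t z).2 ▸
    Finset.single_le_sum (fun i _ => (hv t z).1 i) (Finset.mem_univ y)
  have ha : ∀ t < T, ∀ z ζ, 0 ≤ a t z ζ := by
    intro t ht z ζ
    refine mul_nonneg (div_nonneg ((hK _ _ (A.noise_mem t ht z)).1 ζ) (hg _ _ _ _).le) ?_
    nlinarith [hv1 t z (h (A.feature t z))]
  have hsum : ∀ t < T, ∀ z, ∑ ζ, a t z ζ ≤ κ := by
    intro t ht z
    simp only [a]
    rw [← Finset.sum_mul]
    have h1 := (hg' (A.feature t z) (v t z) (hv t z)).2 _ _ (A.noise_mem t ht z)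
    have h2 := hv1 t z (h (A.feature t z))
    have h3 : 0 ≤ 1 + c * (1 - v t z (h (A.feature t z))) := by nlinarith
    refine (mul_le_mul_of_nonneg_right h1 h3).trans ?_
    -- With m the mistake probability, (1 - cm)(1 + cm) = 1 - (cm)² ≤ 1.
    nlinarith [mul_nonneg (zero_le_one.trans hκ) (sq_nonneg (c * (1 - v t z (h (A.feature t z)))))]
  have hmain := sum_prod_histPrefix_le (zero_le_one.trans hκ) T a ha hsum
  refine le_trans ?_ (mul_le_mul_of_nonneg_left hmain (Nat.cast_nonneg _))
  rw [Finset.mul_sum]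
  refine Finset.sum_le_sum fun z _ => ?_
  let x : Fin T → X := fun t => A.feature t (histPrefix z t t.isLt.le)
  -- The expert may depend on the whole label sequence `z`, because `a` is defined through the true
  -- labels only.
  obtain ⟨i, hi⟩ := hE h hh x
  have hprod := expertWeights_eq_prod (g := g) hi z
  have hle : expertWeights E g T x z i ≤ Fintype.card ι :=
    (Finset.single_le_sum (fun j _ => (expertWeights_pos hg T x z j).le)
      (Finset.mem_univ i)).trans (sum_expertWeights_le hg (fun _ _ hv => (hg' _ _ hv).1) T x z)
  have hpos := expertWeights_pos (E := E) hg T x z i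
  have hfac : ∏ t : Fin T, a t (histPrefix z t t.isLt.le) (z t) =
      A.labelProb z / expertWeights E g T x z i *
        ∏ t : Fin T, (1 + c * (1 - v t (histPrefix z t t.isLt.le)
          (h (A.feature t (histPrefix z t t.isLt.le))))) := by
    rw [hprod]
    simp only [a, Finset.prod_mul_distrib, Finset.prod_div_distrib]
    rfl
  rw [hfac, ← mul_assoc]
  refine mul_le_mul_of_nonneg_right ?_ (Finset.prod_nonneg fun t _ => ?_)
  · rw [mul_div_assoc', le_div_iff₀ hpos, mul_comm]
    exact mul_le_mul_of_nonneg_right hle (A.labelProb_nonneg hK z)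
  · exact add_nonneg zero_le_one (mul_nonneg hc.le (sub_nonneg.mpr (hv1 t _ _)))

/-- If a fixed function agrees with the truth on all features that can be played, no mistake need
be made. -/
theorem highProbRisk_nonpos {H : Set (X → Y)} {δ : ℝ} (hδ : 0 ≤ δ) (f : X → Y)
    (hf : ∀ h ∈ H, ∀ A : Adversary T K h, ∀ t < T, ∀ z : Fin t → Z,
      h (A.feature t z) = f (A.feature t z)) : highProbRisk T H K δ ≤ 0 := by
  classical
  -- The threshold `0` is always reached, even without mistakes; hence positive thresholds and the
  -- infimum.
  refine le_of_forall_pos_le_add fun ε hε => ?_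
  rw [zero_add]
  let Φ : Predictor X Y Z := {
    law := fun t x _ => Pi.single (f (x (Fin.last t))) 1
    law_mem := fun t x _ => single_mem_stdSimplex ℝ _ }
  refine highProbRisk_le hε.le Φ fun h hh A => le_trans (le_of_eq ?_) hδ
  unfold Adversary.errorProb
  refine Finset.sum_eq_zero fun z _ => Finset.sum_eq_zero fun yhat _ => ?_
  split_ifs with hB
  · have hne : A.mistakes z yhat ≠ 0 := by
      intro h0
      rw [h0, Nat.cast_zero] at hB
      exact absurd hB (not_le.mpr hε)
    obtain ⟨t, -, ht⟩ := Finset.exists_ne_zero_of_sum_ne_zero hne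
    have ht' : h (A.feature t (histPrefix z t t.isLt.le)) ≠ yhat t := by
      by_contra hcon
      exact ht (if_neg (not_not.mpr hcon))
    rw [hf h hh A t t.isLt] at ht'
    refine mul_eq_zero_of_right _ (Finset.prod_eq_zero (Finset.mem_univ t) ?_)
    exact Pi.single_eq_of_ne (Ne.symm ht') _
  · rfl

end Risk

/-! ### Randomized response -/

section RandomizedResponse

variable {X Y : Type*}

theorem pointMass_eq_single [DecidableEq Y] (y : Y) : pointMass y = Pi.single y (1 : ℝ) := by
  funext y'
  unfold pointMass
  rw [Pi.single_apply]
  congr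

variable [Fintype Y]

theorem randomizedResponse_valid [Nonempty Y] {η : ℝ} (hη : η ≤ 1) :
    (randomizedResponse X Y η).Valid := by
  classical
  rintro x y p ⟨η', ⟨h0, h1⟩, rfl⟩
  rw [pointMass_eq_single]
  refine convex_stdSimplex ℝ Y (single_mem_stdSimplex ℝ y) ?_ (by linarith) h0 (by ring)
  exact ⟨fun _ => by unfold uniformVec; positivity, by simp [uniformVec]⟩

/-- Update factors for randomized response. -/
theorem exists_update_randomizedResponse {η : ℝ} (h0 : 0 ≤ η) (h1 : η < 1)
    (hN : 2 ≤ Fintype.card Y) (x : X) {v : Y → ℝ} (hv : v ∈ stdSimplex ℝ Y) :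
    ∃ g : Y → Y → ℝ, (∀ y z, 0 < g y z) ∧ (∀ z, ∑ y, v y * g y z ≤ 1) ∧
      ∀ y, ∀ p ∈ randomizedResponse X Y η x y,
        ∑ z, p z / g y z ≤ 1 * (1 - (1 - η) ^ 2 / 2 * (1 - v y)) := by
  classical
  set ε := 1 - η with hε
  have hε0 : 0 < ε := by linarith
  have hε1 : ε ≤ 1 := by linarith
  have hA : ∀ z, 0 < 1 + ε * v z := fun z => by have := hv.1 z; positivity
  have ha : ∀ y z : Y, 0 < if y = z then 1 + ε else 1 := fun y z => by split_ifs <;> linarith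
  -- Experts agreeing with the noisy label gain a factor `1 + ε`; the denominator is the `v`-average
  -- of the numerators.
  refine ⟨fun y z => (if y = z then 1 + ε else 1) / (1 + ε * v z),
    fun y z => div_pos (ha y z) (hA z), fun z => le_of_eq ?_, ?_⟩
  · have h2 : ∀ y, v y * ((if y = z then 1 + ε else 1) / (1 + ε * v z)) =
        (v y + if y = z then ε * v y else 0) / (1 + ε * v z) := by
      intro y
      split_ifs <;> ring
    simp only [h2]
    rw [← Finset.sum_div, Finset.sum_add_distrib, hv.2, Finset.sum_ite_eq' Finset.univ z]
    simp [(hA z).ne']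
  · rintro y p ⟨η', ⟨h2, h3⟩, rfl⟩
    set N : ℝ := (Fintype.card Y : ℝ) with hNdef
    have hN' : (2 : ℝ) ≤ N := by rw [hNdef]; exact_mod_cast hN
    have hv1 : v y ≤ 1 := hv.2 ▸ Finset.single_le_sum (fun i _ => hv.1 i) (Finset.mem_univ y)
    set m := 1 - v y with hm
    have hm0 : 0 ≤ m := by linarith
    set D := ε * m / (1 + ε) with hD
    have hD0 : 0 ≤ D := by positivity
    have hDm : D * (1 + ε) = ε * m := div_mul_cancel₀ _ (by positivity)
    have hyy : (1 + ε * v y) / (1 + ε) = 1 - D := by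
      rw [div_eq_iff (by positivity)]
      linear_combination hDm + ε * hm
    have hterm : ∀ z, ((1 - η') • pointMass y + η' • uniformVec Y) z /
          ((if y = z then 1 + ε else 1) / (1 + ε * v z)) =
        (if y = z then (1 - η') * (1 - D) + η' / N * (1 - D - (1 + ε * v y)) else 0) +
          η' / N * (1 + ε * v z) := by
      intro z
      simp only [Pi.add_apply, Pi.smul_apply, smul_eq_mul, pointMass, uniformVec, ← hNdef]
      by_cases hz : y = z
      · subst hz
        simp only [if_true, ← hyy]
        field_simp
        ring
      · rw [if_neg hz, if_neg hz, if_neg (Ne.symm hz), div_div_eq_mul_div, div_one]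
        ring
    simp only [hterm]
    rw [Finset.sum_add_distrib, Finset.sum_ite_eq, if_pos (Finset.mem_univ y), ← Finset.mul_sum,
      Finset.sum_add_distrib, ← Finset.mul_sum, hv.2, Finset.sum_const, Finset.card_univ,
      nsmul_eq_mul, ← hNdef]
    have hq : η' / N * N = η' := div_mul_cancel₀ _ (by positivity)
    set q := η' / N with hqdef
    have hq0 : 0 ≤ q := by positivity
    have hq2 : q ≤ (1 - ε) / 2 := by nlinarith
    -- The sum to be bounded equals `1 - D * (1 - η' - q * ε)`. Here `η' ≤ 1 - ε`, and `q ≤ (1 - ε)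
    -- / 2` as there are at least two labels; the factor `1 + ε` cancels the denominator of `D`.
    have hkey : ε * (1 + ε) / 2 ≤ 1 - η' - q * ε := by nlinarith
    have h5 := mul_le_mul_of_nonneg_left hkey hD0
    have h6 : D * (ε * (1 + ε) / 2) = ε ^ 2 / 2 * m := by linear_combination ε / 2 * hDm
    rw [h6] at h5
    have h7 : v y = 1 - m := by rw [hm]; ring
    rw [h7]
    nlinarith [hDm, hq, congrArg (fun t => q * t) hDm]

end RandomizedResponse

/-! ### Update factors for Hellinger-separated convex sets -/

theorem nonpos_of_hasDerivAt_of_le {f : ℝ → ℝ} {f' : ℝ} (hf : HasDerivAt f f' 0)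
    (hmax : ∀ s ∈ Set.Icc (0 : ℝ) 1, f s ≤ f 0) : f' ≤ 0 := by
  have ht : Filter.Tendsto (fun s => s⁻¹ • (f (0 + s) - f 0)) (nhdsWithin 0 (Set.Ioi 0))
      (nhds f') := hf.tendsto_slope_zero_right
  refine le_of_tendsto ht ?_
  filter_upwards [Ioo_mem_nhdsGT (zero_lt_one (α := ℝ))] with s hs
  have h1 := hmax s ⟨hs.1.le, hs.2.le⟩
  rw [zero_add, smul_eq_mul]
  exact mul_nonpos_of_nonneg_of_nonpos (inv_nonneg.mpr hs.1.le) (by linarith)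

section Separated

variable {Y Z : Type*} [Fintype Y] [Fintype Z]

/-- Mixtures of pairwise separated subprobability vectors have small total square-root mass. -/
theorem sum_sq_sum_sqrt_le {c : ℝ} (hc1 : c ≤ 1) {lam v : Y → ℝ}
    (hlam : lam ∈ stdSimplex ℝ Y) (hv : v ∈ stdSimplex ℝ Y) {p : Y → Z → ℝ}
    (hp0 : ∀ y z, 0 ≤ p y z) (hp1 : ∀ y, ∑ z, p y z ≤ 1)
    (hsep : ∀ y y', y ≠ y' → ∑ z, √(p y z) * √(p y' z) ≤ 1 - c) :
    ∑ z, (∑ y, √(v y) * √(lam y * p y z)) ^ 2 ≤ 1 - c * ∑ y, lam y * (1 - v y) := by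
  classical
  set a : Y → ℝ := fun y => √(lam y) * √(v y) with ha
  have ha0 : ∀ y, 0 ≤ a y := fun y => by positivity
  have h1 : ∀ z, (∑ y, √(v y) * √(lam y * p y z)) ^ 2 =
      ∑ y, ∑ y', a y * a y' * (√(p y z) * √(p y' z)) := by
    intro z
    rw [sq, Finset.sum_mul_sum]
    refine Finset.sum_congr rfl fun y _ => Finset.sum_congr rfl fun y' _ => ?_
    rw [Real.sqrt_mul (hlam.1 y), Real.sqrt_mul (hlam.1 y')]
    simp only [ha]
    ring
  have h2 : ∀ y y', ∑ z, √(p y z) * √(p y' z) ≤ (1 - c) + if y = y' then c else 0 := by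
    intro y y'
    by_cases hy : y = y'
    · subst hy
      simp only [if_true, Real.mul_self_sqrt (hp0 y _)]
      linarith [hp1 y]
    · rw [if_neg hy]
      linarith [hsep y y' hy]
  -- Cauchy–Schwarz; it will be multiplied by `1 - c`, which must be nonnegative.
  have h3 : (∑ y, a y) ^ 2 ≤ 1 := by
    have h4 := Real.sum_sqrt_mul_sqrt_le Finset.univ hlam.1 hv.1
    rw [hlam.2, hv.2] at h4
    simp only [Real.sqrt_one, mul_one] at h4
    exact pow_le_one₀ (Finset.sum_nonneg fun y _ => ha0 y) h4
  have h5 : ∀ y, a y * a y = lam y * v y := by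
    intro y
    simp only [ha]
    rw [mul_mul_mul_comm, Real.mul_self_sqrt (hlam.1 y), Real.mul_self_sqrt (hv.1 y)]
  calc ∑ z, (∑ y, √(v y) * √(lam y * p y z)) ^ 2
      = ∑ y, ∑ y', a y * a y' * ∑ z, √(p y z) * √(p y' z) := by
        simp only [h1, Finset.mul_sum]
        rw [Finset.sum_comm]
        exact Finset.sum_congr rfl fun y _ => Finset.sum_comm
    _ ≤ ∑ y, ∑ y', a y * a y' * ((1 - c) + if y = y' then c else 0) :=
        Finset.sum_le_sum fun y _ => Finset.sum_le_sum fun y' _ =>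
          mul_le_mul_of_nonneg_left (h2 y y') (mul_nonneg (ha0 y) (ha0 y'))
    _ = (1 - c) * (∑ y, a y) ^ 2 + c * ∑ y, lam y * v y := by
        simp only [mul_add, mul_ite, mul_zero, Finset.sum_add_distrib, Finset.sum_ite_eq,
          Finset.mem_univ, if_true, h5]
        rw [sq, Finset.sum_mul_sum, ← Finset.sum_mul, mul_comm (1 - c)]
        simp only [← Finset.sum_mul]
        ring
    _ ≤ 1 - c * ∑ y, lam y * (1 - v y) := by
        simp only [mul_sub, mul_one, Finset.sum_sub_distrib, hlam.2]
        nlinarith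

/-- A small perturbation changes the total square-root mass little. -/
theorem exists_perturbation (Y Z : Type*) [Fintype Y] [Fintype Z] {κ : ℝ} (hκ : 0 < κ) :
    ∃ ε : ℝ, 0 < ε ∧ ∀ v : Y → ℝ, v ∈ stdSimplex ℝ Y → ∀ r : Y → Z → ℝ,
      (∀ y z, 0 ≤ r y z) → (∀ y z, r y z ≤ 1) →
      ∑ z, (∑ y, √(v y) * √(r y z + ε)) ^ 2 ≤ ∑ z, (∑ y, √(v y) * √(r y z)) ^ 2 + κ := by
  set n : ℝ := (Fintype.card Y : ℝ) with hn
  have ht : Filter.Tendsto (fun e : ℝ => (Fintype.card Z : ℝ) * (n * e * (2 * n + n * e)))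
      (nhdsWithin 0 (Set.Ioi 0)) (nhds 0) := by
    have hcont : Continuous fun e : ℝ => (Fintype.card Z : ℝ) * (n * e * (2 * n + n * e)) := by
      fun_prop
    simpa using (hcont.tendsto 0).mono_left nhdsWithin_le_nhds
  obtain ⟨e, he, he0⟩ := ((ht.eventually (gt_mem_nhds hκ)).and self_mem_nhdsWithin).exists
  -- A square, since √(r + e²) ≤ √r + e holds uniformly down to r = 0.
  refine ⟨e ^ 2, by positivity, fun v hv r hr0 hr1 => ?_⟩
  have hv1 : ∀ y, √(v y) ≤ 1 := fun y => Real.sqrt_le_one.mpr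
    (hv.2 ▸ Finset.single_le_sum (fun i _ => hv.1 i) (Finset.mem_univ y))
  have hz : ∀ z, (∑ y, √(v y) * √(r y z + e ^ 2)) ^ 2 ≤
      (∑ y, √(v y) * √(r y z)) ^ 2 + n * e * (2 * n + n * e) := by
    intro z
    have h1 : ∑ y, √(v y) * √(r y z + e ^ 2) ≤ ∑ y, √(v y) * √(r y z) + n * e := by
      rw [hn, ← nsmul_eq_mul, ← Finset.card_univ, ← Finset.sum_const, ← Finset.sum_add_distrib]
      refine Finset.sum_le_sum fun y _ => ?_
      have h2 : √(r y z + e ^ 2) ≤ √(r y z) + e := by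
        refine Real.sqrt_le_iff.mpr ⟨by positivity, ?_⟩
        nlinarith [Real.sq_sqrt (hr0 y z), Real.sqrt_nonneg (r y z)]
      nlinarith [hv1 y, Real.sqrt_nonneg (v y)]
    have h0 : 0 ≤ ∑ y, √(v y) * √(r y z + e ^ 2) :=
      Finset.sum_nonneg fun y _ => by positivity
    have h3 : ∑ y, √(v y) * √(r y z) ≤ n := by
      rw [hn, ← Finset.card_univ, Finset.card_eq_sum_ones, Nat.cast_sum]
      refine Finset.sum_le_sum fun y _ => ?_
      rw [Nat.cast_one]
      exact mul_le_one₀ (hv1 y) (Real.sqrt_nonneg _) (Real.sqrt_le_one.mpr (hr1 y z))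
    have hn0 : 0 ≤ n * e := by positivity
    nlinarith [pow_le_pow_left₀ h0 h1 2]
  refine (Finset.sum_le_sum fun z _ => hz z).trans ?_
  rw [Finset.sum_add_distrib, Finset.sum_const, Finset.card_univ, nsmul_eq_mul]
  linarith

/-- Update factors for convex compact sets of subprobability vectors with pairwise affinity at
most `1 - c`, from the first-order condition at a maximizer of the total square-root mass. -/
theorem exists_update_of_affinity_le {c κ : ℝ} (hc1 : c ≤ 1) (hκ : 0 < κ)
    {P : Y → Set (Z → ℝ)} (hne : ∀ y, (P y).Nonempty) (hcomp : ∀ y, IsCompact (P y))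
    (hconv : ∀ y, Convex ℝ (P y)) (h0 : ∀ y, ∀ p ∈ P y, ∀ z, 0 ≤ p z)
    (h1 : ∀ y, ∀ p ∈ P y, ∑ z, p z ≤ 1)
    (hsep : ∀ y y', y ≠ y' → ∀ p ∈ P y, ∀ q ∈ P y', ∑ z, √(p z) * √(q z) ≤ 1 - c)
    {v : Y → ℝ} (hv : v ∈ stdSimplex ℝ Y) :
    ∃ g : Y → Z → ℝ, (∀ y z, 0 < g y z) ∧ (∀ z, ∑ y, v y * g y z ≤ 1) ∧
      ∀ y, ∀ p ∈ P y, ∑ z, p z / g y z ≤ 1 + κ - c * (1 - v y) := by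
  classical
  obtain ⟨ε, hε, hpert⟩ := exists_perturbation Y Z hκ
  let D : Set ((Y → ℝ) × (Y → Z → ℝ)) := stdSimplex ℝ Y ×ˢ Set.univ.pi P
  -- The shift `ε` makes the square roots differentiable where `r` vanishes.
  let G : (Y → ℝ) → (Y → Z → ℝ) → ℝ := fun lam r =>
    ∑ z, (∑ y, √(v y) * √(r y z + ε)) ^ 2 + c * ∑ y, lam y * (1 - v y)
  let F : (Y → ℝ) × (Y → Z → ℝ) → ℝ := fun x => G x.1 (fun y z => x.1 y * x.2 y z)
  have hYne : Nonempty Y := by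
    by_contra hcon
    rw [not_nonempty_iff] at hcon
    simpa using hv.2
  have hDcomp : IsCompact D := (isCompact_stdSimplex ℝ Y).prod (isCompact_univ_pi hcomp)
  have hDne : D.Nonempty := by
    choose p hp using hne
    exact ⟨(v, p), hv, fun y _ => hp y⟩
  have hFcont : Continuous F := by
    simp only [F, G]
    fun_prop
  obtain ⟨⟨lam, p⟩, ⟨hlam, hp⟩, hmax⟩ := hDcomp.exists_isMaxOn hDne hFcont.continuousOn
  simp only at hlam hp
  have hp' : ∀ y, p y ∈ P y := fun y => hp y (Set.mem_univ y)
  have hlam1 : ∀ y, lam y ≤ 1 := fun y => hlam.2 ▸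
    Finset.single_le_sum (fun i _ => hlam.1 i) (Finset.mem_univ y)
  let r : Y → Z → ℝ := fun y z => lam y * p y z
  have hr0 : ∀ y z, 0 ≤ r y z := fun y z => mul_nonneg (hlam.1 y) (h0 y _ (hp' y) z)
  have hr1 : ∀ y z, r y z ≤ 1 := fun y z => mul_le_one₀ (hlam1 y) (h0 y _ (hp' y) z)
    ((Finset.single_le_sum (fun i _ => h0 y _ (hp' y) i) (Finset.mem_univ z)).trans
      (h1 y _ (hp' y)))
  have hrε : ∀ y z, 0 < √(r y z + ε) := fun y z =>
    Real.sqrt_pos.mpr (add_pos_of_nonneg_of_pos (hr0 y z) hε)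
  have hG : G lam r ≤ 1 + κ := by
    have h2 := hpert v hv r hr0 hr1
    have h3 := sum_sq_sum_sqrt_le (c := c) hc1 hlam hv (p := p) (fun y => h0 y _ (hp' y))
      (fun y => h1 y _ (hp' y)) (fun y y' hy => hsep y y' hy _ (hp' y) _ (hp' y'))
    simp only [G]
    linarith
  -- values along segments to the vertices
  have hseg : ∀ y0, ∀ q ∈ P y0, ∀ s ∈ Set.Icc (0 : ℝ) 1,
      G (fun y => lam y + s * ((Pi.single y0 1 : Y → ℝ) y - lam y))
        (fun y z => r y z + s * ((Pi.single y0 q : Y → Z → ℝ) y z - r y z)) ≤ G lam r := by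
    intro y0 q hq s hs
    set mu : Y → ℝ := fun y => lam y + s * ((Pi.single y0 1 : Y → ℝ) y - lam y) with hmu
    have hmumem : mu ∈ stdSimplex ℝ Y := by
      have := convex_stdSimplex ℝ Y hlam (single_mem_stdSimplex ℝ y0) (sub_nonneg.mpr hs.2) hs.1
        (by ring)
      convert this using 1
      funext y
      simp only [hmu, Pi.add_apply, Pi.smul_apply, smul_eq_mul]
      ring
    -- In the coordinates `r y = lam y * p y` segments stay in the domain: after division by `mu y`,
    -- the point is a convex combination of `p y` and `q`.
    have hex : ∀ y, ∃ p' ∈ P y, ∀ z, mu y * p' z =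
        r y z + s * ((Pi.single y0 q : Y → Z → ℝ) y z - r y z) := by
      intro y
      by_cases hy : y = y0
      · subst hy
        have hmuy : mu y = (1 - s) * lam y + s := by
          simp only [hmu, Pi.single_eq_same]; ring
        have hA : 0 ≤ (1 - s) * lam y := mul_nonneg (sub_nonneg.mpr hs.2) (hlam.1 y)
        rcases (hmumem.1 y).eq_or_lt with hz | hpos
        · have hs0 : s = 0 := by linarith [hs.1]
          have hl0 : lam y = 0 := by rw [hs0] at hmuy; linarith
          refine ⟨p y, hp' y, fun z => ?_⟩
          rw [← hz, hs0]
          simp [r, hl0]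
        · refine ⟨((1 - s) * lam y / mu y) • p y + (s / mu y) • q,
            hconv y (hp' y) hq (div_nonneg hA hpos.le) (div_nonneg hs.1 hpos.le) ?_, fun z => ?_⟩
          · rw [← add_div, ← hmuy, div_self hpos.ne']
          · simp only [Pi.add_apply, Pi.smul_apply, smul_eq_mul, Pi.single_eq_same, r]
            field_simp
            ring
      · refine ⟨p y, hp' y, fun z => ?_⟩
        simp only [hmu, Pi.single_eq_of_ne hy, r, Pi.zero_apply]
        ring
    choose p' hp'mem hp'eq using hex
    have h2 : F (mu, p') ≤ F (lam, p) := hmax ⟨hmumem, fun y _ => hp'mem y⟩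
    simp only [F, hp'eq] at h2
    exact h2
  let S : Z → ℝ := fun z => ∑ y, √(v y) * √(r y z + ε)
  have hS : ∀ z, 0 < S z := by
    intro z
    obtain ⟨y, hy⟩ : ∃ y, 0 < v y := by
      by_contra! hcon
      have := Finset.sum_nonpos fun y (_ : y ∈ Finset.univ) => hcon y
      rw [hv.2] at this
      linarith
    exact Finset.sum_pos' (fun y _ => by positivity)
      ⟨y, Finset.mem_univ y, mul_pos (Real.sqrt_pos.mpr hy) (hrε y z)⟩
  have hopt : ∀ y0, ∀ q ∈ P y0,
      ∑ z, q z * (S z * √(v y0) / √(r y0 z + ε)) ≤ 1 + κ - c * (1 - v y0) := by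
    intro y0 q hq
    set d : Y → Z → ℝ := fun y z => (Pi.single y0 q : Y → Z → ℝ) y z - r y z with hd
    have hder : HasDerivAt (fun s : ℝ =>
        G (fun y => lam y + s * ((Pi.single y0 1 : Y → ℝ) y - lam y))
          (fun y z => r y z + s * d y z))
        (∑ z, 2 * S z * ∑ y, √(v y) * (d y z / (2 * √(r y z + ε))) +
          c * ∑ y, ((Pi.single y0 1 : Y → ℝ) y - lam y) * (1 - v y)) 0 := by
      refine HasDerivAt.add (HasDerivAt.fun_sum fun z _ => ?_)
        (HasDerivAt.const_mul c (HasDerivAt.fun_sum fun y _ => ?_))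
      · have hin : HasDerivAt (fun s : ℝ => ∑ y, √(v y) * √(r y z + s * d y z + ε))
            (∑ y, √(v y) * (d y z / (2 * √(r y z + ε)))) 0 := by
          refine HasDerivAt.fun_sum fun y _ => HasDerivAt.const_mul _ ?_
          have hl : HasDerivAt (fun s : ℝ => r y z + s * d y z + ε) (d y z) 0 := by
            simpa using (((hasDerivAt_id (0 : ℝ)).mul_const (d y z)).const_add (r y z)).add_const ε
          have := hl.sqrt (by simpa using (add_pos_of_nonneg_of_pos (hr0 y z) hε).ne')
          simpa using this
        simpa [S] using hin.fun_pow 2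
      · simpa using (((hasDerivAt_id (0 : ℝ)).mul_const
          ((Pi.single y0 1 : Y → ℝ) y - lam y)).const_add (lam y)).mul_const (1 - v y)
    have hle := nonpos_of_hasDerivAt_of_le hder (fun s hs => by
      simpa [hd] using hseg y0 q hq s hs)
    have hlin : ∑ y, ((Pi.single y0 1 : Y → ℝ) y - lam y) * (1 - v y) =
        (1 - v y0) - ∑ y, lam y * (1 - v y) := by
      simp only [sub_mul, Finset.sum_sub_distrib, Pi.single_apply, ite_mul, one_mul, zero_mul,
        Finset.sum_ite_eq', Finset.mem_univ, if_true]
    -- Euler's relation: `S z ^ 2` is homogeneous of degree one in `r + ε`. Only nonnegative terms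
    -- are dropped, those of the other labels and of `ε`.
    have hz : ∀ z, q z * (S z * √(v y0) / √(r y0 z + ε)) ≤
        2 * S z * ∑ y, √(v y) * (d y z / (2 * √(r y z + ε))) + S z ^ 2 := by
      intro z
      have e1 : 2 * S z * ∑ y, √(v y) * (d y z / (2 * √(r y z + ε))) + S z ^ 2 =
          S z * ∑ y, √(v y) * ((d y z + (r y z + ε)) / √(r y z + ε)) := by
        have e2 : ∀ y, √(v y) * ((d y z + (r y z + ε)) / √(r y z + ε)) =
            2 * (√(v y) * (d y z / (2 * √(r y z + ε)))) + √(v y) * √(r y z + ε) := by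
          intro y
          rw [add_div, Real.div_sqrt, mul_comm 2 (√(r y z + ε)), ← div_div]
          ring
        simp only [e2, Finset.sum_add_distrib, ← Finset.mul_sum]
        change _ = S z * (_ + S z)
        ring
      rw [e1, show q z * (S z * √(v y0) / √(r y0 z + ε)) =
        S z * (√(v y0) * (q z / √(r y0 z + ε))) by ring]
      refine mul_le_mul_of_nonneg_left ?_ (hS z).le
      have e3 : ∀ y, d y z + (r y z + ε) = (Pi.single y0 q : Y → Z → ℝ) y z + ε := by
        intro y; simp only [hd]; ring
      have hnn : ∀ y, 0 ≤ (Pi.single y0 q : Y → Z → ℝ) y z := by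
        intro y
        by_cases hy : y = y0
        · subst hy; simpa using h0 y q hq z
        · simp [Pi.single_eq_of_ne hy]
      simp only [e3]
      refine le_trans ?_ (Finset.single_le_sum (fun y _ => ?_) (Finset.mem_univ y0))
      · rw [Pi.single_eq_same]
        refine mul_le_mul_of_nonneg_left ?_ (Real.sqrt_nonneg _)
        exact div_le_div_of_nonneg_right (by linarith) (hrε y0 z).le
      · have := hnn y
        positivity
    have hsum := Finset.sum_le_sum fun z (_ : z ∈ Finset.univ) => hz z
    rw [Finset.sum_add_distrib] at hsum
    rw [hlin] at hle
    have hG' : ∑ z, S z ^ 2 + c * ∑ y, lam y * (1 - v y) ≤ 1 + κ := hG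
    rw [mul_sub] at hle
    linarith
  -- The reciprocal of the gradient factor in `hopt`. A label with `v y = 0` is absent from the
  -- normalization, and `κ⁻¹` makes its sum at most `κ ≤ 1 + κ - c`.
  refine ⟨fun y z => if v y = 0 then κ⁻¹ else √(r y z + ε) / (S z * √(v y)), fun y z => ?_,
    fun z => le_of_eq ?_, fun y q hq => ?_⟩
  · dsimp only
    split_ifs with hy
    · positivity
    · exact div_pos (hrε y z) (mul_pos (hS z)
        (Real.sqrt_pos.mpr (lt_of_le_of_ne (hv.1 y) (Ne.symm hy))))
  · have e : ∀ y, v y * (if v y = 0 then κ⁻¹ else √(r y z + ε) / (S z * √(v y))) =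
        √(v y) * √(r y z + ε) / S z := by
      intro y
      split_ifs with hy
      · simp [hy]
      · have hvpos : 0 < √(v y) := Real.sqrt_pos.mpr (lt_of_le_of_ne (hv.1 y) (Ne.symm hy))
        rw [div_mul_eq_div_div, ← mul_div_assoc, ← mul_div_assoc, div_right_comm, mul_div_right_comm,
          mul_div_right_comm, Real.div_sqrt]
        ring
    simp only [e, ← Finset.sum_div]
    exact div_self (hS z).ne'
  · by_cases hy : v y = 0
    · simp only [hy, if_true, div_inv_eq_mul, ← Finset.sum_mul]
      nlinarith [h1 y q hq]
    · simp only [hy, if_false]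
      refine le_trans (le_of_eq (Finset.sum_congr rfl fun z _ => ?_)) (hopt y q hq)
      rw [div_div_eq_mul_div, mul_div_assoc]

end Separated

/-! ### The risk bounds -/

theorem NoisyKernel.WellSeparated.le {X Y Z : Type*} {K : NoisyKernel X Y Z}
    {D : (Z → ℝ) → (Z → ℝ) → ℝ} {γ : ℝ} (hK : K.WellSeparated D γ) {x : X} {y y' : Y} (hy : y ≠ y') {p q : Z → ℝ} (hp : p ∈ K x y)
    (hq : q ∈ K x y') : γ ≤ D p q := by
  have h1 : ENNReal.ofReal γ ≤ ENNReal.ofReal (D p q) :=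
    (hK.2 x y y' hy).trans ((iInf₂_le p hp).trans (iInf₂_le q hq))
  exact (ENNReal.ofReal_le_ofReal_iff' (p := γ) (q := D p q)).mp h1 |>.resolve_right
    (not_le.mpr hK.1)

section Bounds

variable {X Y Z : Type*} [Fintype Y] [Fintype Z]

theorem hellingerSq_eq {p q : Z → ℝ} (hp : p ∈ stdSimplex ℝ Z) (hq : q ∈ stdSimplex ℝ Z) :
    hellingerSq p q = 2 - 2 * ∑ z, √(p z) * √(q z) := by
  have h : ∀ z, (√(p z) - √(q z)) ^ 2 = p z + q z - 2 * (√(p z) * √(q z)) := by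
    intro z
    linear_combination Real.sq_sqrt (hp.1 z) + Real.sq_sqrt (hq.1 z)
  unfold hellingerSq
  simp only [h, Finset.sum_sub_distrib, Finset.sum_add_distrib, ← Finset.mul_sum, hp.2, hq.2]
  norm_num

/-- Update factors for a Hellinger-separated kernel. -/
theorem exists_update_of_wellSeparated {K : NoisyKernel X Y Z} (hK : K.Valid)
    (hconv : ∀ x y, Convex ℝ (K x y)) (hcl : ∀ x y, IsClosed (K x y)) {γ : ℝ} (hγ : γ ≤ 2)
    (hsep : K.WellSeparated hellingerSq γ) {κ : ℝ} (hκ0 : 0 < κ) (hκ1 : κ ≤ 1) (x : X)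
    {v : Y → ℝ} (hv : v ∈ stdSimplex ℝ Y) :
    ∃ g : Y → Z → ℝ, (∀ y z, 0 < g y z) ∧ (∀ z, ∑ y, v y * g y z ≤ 1) ∧
      ∀ y, ∀ p ∈ K x y, ∑ z, p z / g y z ≤ (1 + κ) * (1 - γ / 4 * (1 - v y)) := by
  classical
  -- an empty set is replaced by the zero vector
  let P : Y → Set (Z → ℝ) := fun y => if (K x y).Nonempty then K x y else {0}
  have hP : ∀ y, (P y = K x y ∧ (K x y).Nonempty) ∨ P y = {0} := by
    intro y
    by_cases hy : (K x y).Nonempty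
    · exact Or.inl ⟨if_pos hy, hy⟩
    · exact Or.inr (if_neg hy)
  have hsub : ∀ y, ∀ p ∈ P y, p ∈ K x y ∨ p = 0 := by
    intro y p hp
    rcases hP y with ⟨h, -⟩ | h <;> rw [h] at hp
    exacts [Or.inl hp, Or.inr hp]
  obtain ⟨g, hg, hg1, hg2⟩ := exists_update_of_affinity_le (c := γ / 2) (κ := κ) (P := P)
    (by linarith) hκ0
    (fun y => by
      rcases hP y with ⟨h, h'⟩ | h <;> rw [h]
      exacts [h', Set.singleton_nonempty 0])
    (fun y => by
      rcases hP y with ⟨h, -⟩ | h <;> rw [h]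
      exacts [(isCompact_stdSimplex ℝ Z).of_isClosed_subset (hcl x y) (hK x y),
        isCompact_singleton])
    (fun y => by
      rcases hP y with ⟨h, -⟩ | h <;> rw [h]
      exacts [hconv x y, convex_singleton 0])
    (fun y p hp z => by
      rcases hsub y p hp with h | rfl
      exacts [(hK x y h).1 z, le_rfl])
    (fun y p hp => by
      rcases hsub y p hp with h | rfl
      exacts [(hK x y h).2.le, by simp])
    (fun y y' hy p hp q hq => by
      rcases hsub y p hp with h | rfl
      · rcases hsub y' q hq with h' | rfl
        · have := hsep.le hy h h'
          rw [hellingerSq_eq (hK x y h) (hK x y' h')] at this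
          linarith
        -- The zero vector has affinity zero with everything, and `γ ≤ 2`.
        · simpa using by linarith
      · simpa using by linarith)
    hv
  refine ⟨g, hg, hg1, fun y p hp => (hg2 y p ?_).trans ?_⟩
  · rwa [show P y = K x y from if_pos ⟨p, hp⟩]
  · have hv1 : v y ≤ 1 := hv.2 ▸ Finset.single_le_sum (fun i _ => hv.1 i) (Finset.mem_univ y)
    have h1 : 0 ≤ γ * (1 - v y) := mul_nonneg hsep.1.le (sub_nonneg.mpr hv1)
    -- `1 + κ ≤ 2` is why `γ / 2` becomes `γ / 4` in the product form.
    nlinarith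

theorem mul_le_mul_one_add_rpow {M k δ c B a b : ℝ} (hδ : 0 < δ) (hc0 : 0 ≤ c) (hc1 : c ≤ 1)
    (hB0 : 0 ≤ B) (hM : M ≤ Real.exp a) (hk0 : 0 ≤ k) (hk : k ≤ Real.exp b)
    (hB : a + b + Real.log (1 / δ) ≤ B * (c / 2)) : M * k ≤ δ * (1 + c) ^ B := by
  -- Through 2c/(c+2) ≤ log(1+c), using `c ≤ 1`.
  have hlog : c / 2 ≤ Real.log (1 + c) := by
    refine le_trans ?_ (Real.le_log_one_add_of_nonneg hc0)
    rw [div_le_div_iff₀ two_pos (by linarith)]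
    nlinarith
  calc M * k ≤ Real.exp a * Real.exp b := mul_le_mul hM hk hk0 (Real.exp_pos a).le
    _ = Real.exp (a + b) := (Real.exp_add a b).symm
    _ ≤ Real.exp (Real.log δ + Real.log (1 + c) * B) := by
        rw [one_div, Real.log_inv] at hB
        refine Real.exp_le_exp.mpr ?_
        nlinarith
    _ = δ * (1 + c) ^ B := by
        rw [Real.exp_add, Real.exp_log hδ, Real.rpow_def_of_pos (by linarith)]

/-- The risk bound for a class of finite Littlestone dimension in terms of the update factors. -/
theorem highProbRisk_le_of_littlestoneDim {H : Set (X → Y)} {K : NoisyKernel X Y Z} {L T : ℕ}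
    (hN : 2 ≤ Fintype.card Y) (hT : 1 ≤ T) (hL : littlestoneDim H = (L : ℕ∞)) (hK : K.Valid)
    {κ c b δ B : ℝ} (hδ : 0 < δ) (hκ : 1 ≤ κ) (hc0 : 0 < c) (hc1 : c ≤ 1)
    (hup : ∀ x, ∀ v ∈ stdSimplex ℝ Y, ∃ g : Y → Z → ℝ, (∀ y z, 0 < g y z) ∧
      (∀ z, ∑ y, v y * g y z ≤ 1) ∧
      ∀ y, ∀ p ∈ K x y, ∑ z, p z / g y z ≤ κ * (1 - c * (1 - v y)))
    (hκT : κ ^ T ≤ Real.exp b) (hB0 : 0 ≤ B)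
    (hB : ((L : ℝ) + 1) * Real.log ((T : ℝ) * (Fintype.card Y : ℝ)) + b + Real.log (1 / δ) ≤
      B * (c / 2)) :
    highProbRisk T H K δ ≤ B := by
  have hYne : Nonempty Y := Fintype.card_pos_iff.mp (by omega)
  have hcover := fun h (hh : h ∈ H) =>
    exists_expert (not_shattersDepth_of_littlestoneDim_eq hL) hh T
  have := Fintype.ofFinite (Overrides Y T L)
  refine highProbRisk_le_of_updates hK (fun t x (o : Overrides Y T L) => soaExpert H L o.extend t x)
    hcover hκ hc0 hup hB0 (mul_le_mul_one_add_rpow hδ hc0.le hc1 hB0 ?_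
      (pow_nonneg (zero_le_one.trans hκ) T) hκT hB)
  have hpos : (0 : ℝ) < (T : ℝ) * Fintype.card Y := by
    have : 0 < T * Fintype.card Y := Nat.mul_pos hT (by omega)
    exact_mod_cast this
  have hcard := card_overrides_le (Y := Y) T L hT hN
  rw [Nat.card_eq_fintype_card] at hcard
  refine hcard.trans (le_of_eq ?_)
  rw [← Real.exp_log (pow_pos hpos (L + 1)), Real.log_pow]
  push_cast
  rfl

theorem highProbRisk_randomizedResponse_le (H : Set (X → Y)) (L T : ℕ) (η δ : ℝ)
    (hN : 2 ≤ Fintype.card Y) (hT : 1 ≤ T) (hδ0 : 0 < δ) (hδ1 : δ ≤ 1) (hη0 : 0 ≤ η) (hη1 : η < 1)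
    (hL : littlestoneDim H = (L : ℕ∞)) :
    highProbRisk T H (randomizedResponse X Y η) δ ≤
      (((L : ℝ) + 1) * Real.log ((T : ℝ) * (Fintype.card Y : ℝ)) +
        2 * Real.log (1 / δ)) / ((1 - η) ^ 2 / 4) := by
  have hYne : Nonempty Y := Fintype.card_pos_iff.mp (by omega)
  have hη : 0 < 1 - η := by linarith
  have hlogδ : 0 ≤ Real.log (1 / δ) := Real.log_nonneg ((one_le_div hδ0).mpr hδ1)
  have hlog : 0 ≤ Real.log ((T : ℝ) * (Fintype.card Y : ℝ)) := by
    exact_mod_cast Real.log_natCast_nonneg (T * Fintype.card Y)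
  refine highProbRisk_le_of_littlestoneDim hN hT hL (randomizedResponse_valid hη1.le)
    (κ := 1) (c := (1 - η) ^ 2 / 2) (b := 0) hδ0 le_rfl (by positivity) (by nlinarith)
    (fun x v hv => exists_update_randomizedResponse hη0 hη1 hN x hv) (by simp) (by positivity) ?_
  rw [show (1 - η) ^ 2 / 2 / 2 = (1 - η) ^ 2 / 4 by ring, div_mul_cancel₀ _ (by positivity)]
  linarith

theorem highProbRisk_wellSeparated_le (H : Set (X → Y)) (K : NoisyKernel X Y Z) (L T : ℕ)
    (γ δ : ℝ) (hN : 2 ≤ Fintype.card Y) (hT : 1 ≤ T) (hδ0 : 0 < δ) (hδ1 : δ ≤ 1)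
    (hL : littlestoneDim H = (L : ℕ∞)) (hK : K.Valid) (hconv : ∀ x y, Convex ℝ (K x y))
    (hcl : ∀ x y, IsClosed (K x y)) (hsep : K.WellSeparated hellingerSq γ) :
    highProbRisk T H K δ ≤
      16 * (((L : ℝ) ^ 2 * Real.log ((T : ℝ) * (Fintype.card Y : ℝ)) ^ 2 +
        (L : ℝ) * Real.log (4 * (T : ℝ) * (Fintype.card Y : ℝ) / δ)) / γ) := by
  have hYne : Nonempty Y := Fintype.card_pos_iff.mp (by omega)
  have hγ0 := hsep.1
  have hT' : (1 : ℝ) ≤ T := by exact_mod_cast hT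
  have hN' : (2 : ℝ) ≤ Fintype.card Y := by exact_mod_cast hN
  have hTN : (1 : ℝ) ≤ (T : ℝ) * Fintype.card Y := by nlinarith
  set l := Real.log ((T : ℝ) * (Fintype.card Y : ℝ)) with hl
  set u := Real.log (1 / δ) with hu
  have hl0 : 0 ≤ l := Real.log_nonneg hTN
  have hu0 : 0 ≤ u := Real.log_nonneg ((one_le_div hδ0).mpr hδ1)
  have hsplit : Real.log (4 * (T : ℝ) * (Fintype.card Y : ℝ) / δ) = Real.log 4 + l + u := by
    rw [hl, hu, ← Real.log_mul (by norm_num) (by positivity),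
      ← Real.log_mul (by positivity) (by positivity)]
    congr 1
    ring
  have h4 : 1 ≤ Real.log 4 := by
    rw [Real.le_log_iff_exp_le (by norm_num)]
    linarith [Real.exp_one_lt_d9]
  rw [hsplit]
  have hbound : 0 ≤ 16 * (((L : ℝ) ^ 2 * l ^ 2 + (L : ℝ) * (Real.log 4 + l + u)) / γ) := by
    positivity
  -- For `L = 0` the claimed bound is zero; the class then has at most one hypothesis, which the
  -- learner copies.
  rcases Nat.eq_zero_or_pos L with rfl | hLpos
  · refine le_trans ?_ hbound
    rcases H.eq_empty_or_nonempty with rfl | ⟨f, hf⟩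
    · exact highProbRisk_nonpos hδ0.le (fun _ => Classical.arbitrary Y) fun h hh => hh.elim
    · refine highProbRisk_nonpos hδ0.le f fun h hh A t _ z => ?_
      by_contra hne
      exact not_shattersDepth_of_littlestoneDim_eq hL
        (shattersDepth_succ hne (shattersDepth_zero ⟨hh, rfl⟩) (shattersDepth_zero ⟨hf, rfl⟩))
  rcases lt_or_ge 2 γ with hγ | hγ
  · -- at most one label is possible at each feature
    refine le_trans ?_ hbound
    have huniq : ∀ x y y', (K x y).Nonempty → (K x y').Nonempty → y = y' := by
      rintro x y y' ⟨p, hp⟩ ⟨q, hq⟩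
      by_contra hne
      have h1 := hsep.le hne hp hq
      rw [hellingerSq_eq (hK x y hp) (hK x y' hq)] at h1
      have h2 : 0 ≤ ∑ z, √(p z) * √(q z) := Finset.sum_nonneg fun z _ => by positivity
      linarith
    have hex : ∀ x, ∃ y0, ∀ y, (K x y).Nonempty → y = y0 := by
      intro x
      by_cases hx : ∃ y, (K x y).Nonempty
      · obtain ⟨y0, hy0⟩ := hx
        exact ⟨y0, fun y hy => huniq x y y0 hy hy0⟩
      · exact ⟨Classical.arbitrary Y, fun y hy => absurd ⟨y, hy⟩ hx⟩
    choose f hf using hex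
    exact highProbRisk_nonpos hδ0.le f fun h _ A t ht z => hf _ _ ⟨_, A.noise_mem t ht z⟩
  · have hL' : (1 : ℝ) ≤ L := by exact_mod_cast hLpos
    have hκ1 : 1 / (T : ℝ) ≤ 1 := (div_le_one (by linarith)).mpr hT'
    -- A perturbation of size `1 / T` per round costs at most a factor e in total, hence `b := 1`.
    refine highProbRisk_le_of_littlestoneDim hN hT hL hK (κ := 1 + 1 / (T : ℝ)) (c := γ / 4)
      (b := 1) hδ0 (le_add_of_nonneg_right (by positivity)) (by positivity) (by linarith)
      (fun x v hv => exists_update_of_wellSeparated hK hconv hcl hγ hsep (by positivity) hκ1 x hv)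
      (one_add_inv_pow_le_exp_one hT) hbound ?_
    rw [← hl, ← hu]
    have e : 16 * (((L : ℝ) ^ 2 * l ^ 2 + (L : ℝ) * (Real.log 4 + l + u)) / γ) * (γ / 4 / 2) =
        2 * ((L : ℝ) ^ 2 * l ^ 2 + (L : ℝ) * (Real.log 4 + l + u)) := by
      field_simp
      norm_num
    rw [e]
    -- The quadratic term is simply discarded: the part linear in `L` already suffices.
    have h1 : 0 ≤ (L : ℝ) ^ 2 * l ^ 2 := by positivity
    have h2 : 0 ≤ ((L : ℝ) - 1) * (Real.log 4 + l + u) := by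
      apply mul_nonneg <;> linarith
    have h3 : 0 ≤ ((L : ℝ) - 1) * (l + u) := by apply mul_nonneg <;> linarith
    nlinarith

end Bounds

theorem mainTheorem10 :
    (∃ C : ℝ, 0 < C ∧
      ∀ (X : Type*) (Y : Type*) (Z : Type*) [Fintype Y] [Fintype Z]
        (H : Set (X → Y)) (K : NoisyKernel X Y Z) (L T : ℕ) (γ δ : ℝ),
        2 ≤ Fintype.card Y → 1 ≤ T → 0 < δ → δ ≤ 1 →
        littlestoneDim H = (L : ℕ∞) →
        K.Valid → (∀ x y, Convex ℝ (K x y)) → (∀ x y, IsClosed (K x y)) →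
        K.WellSeparated hellingerSq γ →
        highProbRisk T H K δ ≤
          C * (((L : ℝ) ^ 2 * Real.log ((T : ℝ) * (Fintype.card Y : ℝ)) ^ 2 +
            (L : ℝ) * Real.log (4 * (T : ℝ) * (Fintype.card Y : ℝ) / δ)) / γ)) ∧
    (∀ (X : Type*) (Y : Type*) [Fintype Y]
        (H : Set (X → Y)) (L T : ℕ) (η δ : ℝ),
        2 ≤ Fintype.card Y → 1 ≤ T → 0 < δ → δ ≤ 1 → 0 ≤ η → η < 1 →
        littlestoneDim H = (L : ℕ∞) →
        highProbRisk T H (randomizedResponse X Y η) δ ≤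
          (((L : ℝ) + 1) * Real.log ((T : ℝ) * (Fintype.card Y : ℝ)) +
            2 * Real.log (1 / δ)) / ((1 - η) ^ 2 / 4)) := by
  refine ⟨⟨16, by norm_num, ?_⟩, ?_⟩
  · intro X Y Z _ _ H K L T γ δ hN hT hδ0 hδ1 hL hK hconv hcl hsep
    exact highProbRisk_wellSeparated_le H K L T γ δ hN hT hδ0 hδ1 hL hK hconv hcl hsep
  · intro X Y _ H L T η δ hN hT hδ0 hδ1 hη0 hη1 hL
    exact highProbRisk_randomizedResponse_le H L T η δ hN hT hδ0 hδ1 hη0 hη1 hL
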